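/- Let $n\ge 1$, let $a<b$ be real numbers, and let $\gamma:[a,b]\to\mathbb{R}^n$ be a curve that is continuous on $[a,b]$ and of class $C^n$ on $(a,b)$, and that has totally positive torsion, i.e. for every $t\in(a,b)$ all leading principal minors of the $n\times n$ matrix $(\gamma'(t),\gamma''(t),\ldots,\gamma^{(n)}(t))$ with columns $\gamma^{(j)}(t)$ are positive. For $x\in\mathrm{conv}(\gamma([a,b]))$ let $b(x)$ be the smallest integer $k$ such that $x$ is a convex combination of $k$ points of $\gamma([a,b])$. Then the Carathéodory number $$b(\gamma):=\sup_{x\in\mathrm{conv}(\gamma([a,b]))} b(x)$$ of $\gamma([a,b])$, i.e. the smallest integer $k$ such that every point of $\mathrm{conv}(\gamma([a,b]))$ is a convex combination of at most $k$ points of $\gamma([a,b])$, equals $\left\lfloor \frac{n+2}{2}\right\rfloor$. -/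

import Mathlib

/-- The `n × n` matrix `(γ'(t), γ''(t), …, γ⁽ⁿ⁾(t))`: its `j`-th column (counted from `0`) is the
derivative of order `j + 1` of `γ` at `t`. -/
noncomputable def torsionMatrix {n : ℕ} (γ : ℝ → Fin n → ℝ) (t : ℝ) : Matrix (Fin n) (Fin n) ℝ :=
  Matrix.of fun i j => iteratedDeriv ((j : ℕ) + 1) γ t i

/-- The leading principal minor of order `k` of an `n × n` matrix: the determinant of its
upper left `k × k` block. -/
def leadingPrincipalMinor {n : ℕ} (A : Matrix (Fin n) (Fin n) ℝ) (k : ℕ) (hk : k ≤ n) : ℝ :=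
  (A.submatrix (Fin.castLE hk) (Fin.castLE hk)).det

/-- All leading principal minors of `(γ'(t), …, γ⁽ⁿ⁾(t))` are positive for all `t ∈ (a, b)`.
On the open interval this only involves the values of `γ` on `(a, b)`. -/
def HasTotallyPositiveTorsion {n : ℕ} (γ : ℝ → Fin n → ℝ) (a b : ℝ) : Prop :=
  ∀ t ∈ Set.Ioo a b, ∀ (k : ℕ) (hk : k ≤ n), 1 ≤ k →
    0 < leadingPrincipalMinor (torsionMatrix γ t) k hk

/-- `x` is a convex combination of `k` points of `S`; repetitions and zero weights are allowed,
so this means a convex combination of at most `k` points. -/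
def IsConvexCombinationOf {E : Type*} [AddCommGroup E] [Module ℝ E] (S : Set E) (k : ℕ) (x : E) :
    Prop :=
  ∃ (p : Fin k → E) (c : Fin k → ℝ),
    (∀ i, p i ∈ S) ∧ (∀ i, 0 ≤ c i) ∧ ∑ i, c i = 1 ∧ ∑ i, c i • p i = x

/-- The Carathéodory number of a point `x` with respect to `S`: the least `k` such that `x` is a
convex combination of `k` points of `S` (`⊤` if there is none). -/
noncomputable def caratheodoryNumberAt {E : Type*} [AddCommGroup E] [Module ℝ E] (S : Set E)
    (x : E) : ℕ∞ :=
  ⨅ (k : ℕ) (_ : IsConvexCombinationOf S k x), (k : ℕ∞)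

/-- The Carathéodory number of `S`: the supremum of the Carathéodory numbers of the points of the
convex hull of `S`. -/
noncomputable def caratheodoryNumber {E : Type*} [AddCommGroup E] [Module ℝ E] (S : Set E) : ℕ∞ :=
  ⨆ x ∈ convexHull ℝ S, caratheodoryNumberAt S x

/-! Everything rests on counting zeros of affine functionals `c₀ + c ⬝ᵥ γ t`. The leading Wronskians
of the coordinates of `γ'` are the minors assumed positive, so these coordinates form a Chebyshev
system: for `c ≠ 0` the derivative of the functional has fewer than `n` zeros in `(a, b)`. By Rolle,
a nonzero functional has at most `n` zeros on `[a, b]`.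

Upper bound: take the shortest initial arc whose hull contains `x`. Then `x` lies on a supporting
hyperplane of that arc, and so do all points that represent it with positive weights. Zeros of a
nonnegative functional in the interior of the arc are critical points; adding the Rolle points
doubles the count and leaves room for only `(n + 2) / 2` zeros.

Lower bound: the barycentre of any `(n + 2) / 2` curve points has no shorter representation, since
at most `n` curve points can be separated from any further one by an affine functional vanishing on
them. -/

/-! ### Wronskians and Chebyshev systems -/

/-- Dividing a system of functions by its first member and differentiating lowers the order of
the Wronskian by one. -/
theorem wronskian_reduction {k : ℕ} (f : Fin (k + 1) → ℝ → ℝ) (t : ℝ)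
    (hf : ∀ i, ContDiffAt ℝ k (f i) t) (h0 : f 0 t ≠ 0) :
    (Matrix.of fun i j : Fin (k + 1) => iteratedDeriv (j : ℕ) (f i) t).det =
      f 0 t ^ (k + 1) *
        (Matrix.of fun i j : Fin k =>
          iteratedDeriv (j : ℕ) (deriv fun s => f i.succ s / f 0 s) t).det := by
  set g : Fin (k + 1) → ℝ → ℝ := fun i s => f i s / f 0 s with hg
  have hne : ∀ᶠ s in nhds t, f 0 s ≠ 0 := (hf 0).continuousAt.eventually_ne h0
  have hgc : ∀ i, ContDiffAt ℝ k (g i) t := fun i => (hf i).div (hf 0) h0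
  have hfg : ∀ i, f i =ᶠ[nhds t] g i * f 0 := fun i => by
    filter_upwards [hne] with s hs
    simp [hg, hs]
  let G : Matrix (Fin (k + 1)) (Fin (k + 1)) ℝ :=
    Matrix.of fun i j => iteratedDeriv (j : ℕ) (g i) t
  -- Leibniz' rule for `g i * f 0` is multiplication by `T`, which is upper triangular with diagonal
  -- entries `f 0 t`.
  let T : Matrix (Fin (k + 1)) (Fin (k + 1)) ℝ :=
    Matrix.of fun l j => if (l : ℕ) ≤ j then
      ((j : ℕ).choose l : ℝ) * iteratedDeriv ((j : ℕ) - l) (f 0) t else 0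
  have hGT : (Matrix.of fun i j : Fin (k + 1) => iteratedDeriv (j : ℕ) (f i) t) = G * T := by
    ext i j
    have hj : ((j : ℕ) : WithTop ℕ∞) ≤ k := by exact_mod_cast Nat.lt_succ_iff.mp j.2
    rw [Matrix.mul_apply, Matrix.of_apply, (hfg i).iteratedDeriv_eq,
      iteratedDeriv_mul ((hgc i).of_le hj) ((hf 0).of_le hj)]
    simp only [G, T, Matrix.of_apply]
    rw [Fin.sum_univ_eq_sum_range (fun l => iteratedDeriv l (g i) t *
      if l ≤ (j : ℕ) then ((j : ℕ).choose l : ℝ) * iteratedDeriv ((j : ℕ) - l) (f 0) t else 0)]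
    have hsub : Finset.range ((j : ℕ) + 1) ⊆ Finset.range (k + 1) :=
      Finset.range_subset_range.2 j.2
    rw [← Finset.sum_subset hsub]
    · refine Finset.sum_congr rfl fun l hl => ?_
      rw [if_pos (by simpa [Nat.lt_succ_iff] using hl)]
      ring
    · intro l _ hl
      rw [if_neg (by simpa [Nat.lt_succ_iff] using hl), mul_zero]
  have hT : T.det = f 0 t ^ (k + 1) := by
    rw [Matrix.det_of_isUpperTriangular]
    · simp [T]
    · intro i j hij
      have : ¬ (i : ℕ) ≤ j := not_le.2 hij
      exact if_neg this
  have hG : G.det = (Matrix.of fun i j : Fin k =>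
      iteratedDeriv (j : ℕ) (deriv fun s => f i.succ s / f 0 s) t).det := by
    have hg0 : g 0 =ᶠ[nhds t] fun _ => 1 := by
      filter_upwards [hne] with s hs
      simp [hg, hs]
    have hrow : ∀ j : Fin (k + 1), G 0 j = if j = 0 then 1 else 0 := by
      intro j
      simp only [G, Matrix.of_apply]
      rw [hg0.iteratedDeriv_eq, iteratedDeriv_const]
      simp only [Fin.val_eq_zero_iff]
    rw [Matrix.det_succ_row_zero, Fin.sum_univ_succ]
    simp only [hrow, Fin.succ_ne_zero, if_false, if_true]
    simp only [Fin.val_zero, pow_zero, mul_one, one_mul, mul_zero, zero_mul,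
      Finset.sum_const_zero, add_zero]
    congr 1
    ext i j
    simp [G, hg, iteratedDeriv_succ']
  rw [hGT, Matrix.det_mul, hT, hG, mul_comm]

/-- Iterated form of Rolle's theorem: one zero of the derivative in every gap. -/
theorem exists_deriv_zeros_between {g : ℝ → ℝ} {a b : ℝ} (hg : ContinuousOn g (Set.Icc a b))
    {m : ℕ} (t : Fin (m + 1) → ℝ) (ht : StrictMono t) (hmem : ∀ i, t i ∈ Set.Icc a b)
    (hzero : ∀ i, g (t i) = 0) :
    ∃ s : Fin m → ℝ, ∀ i, t i.castSucc < s i ∧ s i < t i.succ ∧ deriv g (s i) = 0 := by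
  have : ∀ i : Fin m, ∃ s, t i.castSucc < s ∧ s < t i.succ ∧ deriv g s = 0 := by
    intro i
    obtain ⟨s, hs, hs'⟩ := exists_deriv_eq_zero (ht i.castSucc_lt_succ)
      (hg.mono (Set.Icc_subset_Icc (hmem _).1 (hmem _).2)) ((hzero _).trans (hzero _).symm)
    exact ⟨s, hs.1, hs.2, hs'⟩
  choose s hs using this
  exact ⟨s, hs⟩

theorem strictMono_of_between {m : ℕ} {t : Fin (m + 1) → ℝ} (ht : StrictMono t) {s : Fin m → ℝ}
    (hs : ∀ i, t i.castSucc < s i ∧ s i < t i.succ) : StrictMono s := by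
  intro i j hij
  have h : i.succ ≤ j.castSucc := by
    rw [Fin.le_def, Fin.val_succ, Fin.val_castSucc]
    exact hij
  exact (hs i).2.trans_le ((ht.monotone h).trans (hs j).1.le)

/-- A system of `n` functions on an open interval whose leading Wronskians do not vanish is a
Chebyshev system. -/
theorem eq_zero_of_wronskian_ne_zero {a b : ℝ} : ∀ {n : ℕ} (f : Fin n → ℝ → ℝ),
    (∀ i, ContDiffOn ℝ (n - 1 : ℕ) (f i) (Set.Ioo a b)) →
    (∀ t ∈ Set.Ioo a b, ∀ (k : ℕ) (hk : k ≤ n),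
      (Matrix.of fun i j : Fin k => iteratedDeriv (j : ℕ) (f (Fin.castLE hk i)) t).det ≠ 0) →
    ∀ (c : Fin n → ℝ) (z : Fin n → ℝ), StrictMono z → (∀ i, z i ∈ Set.Ioo a b) →
    (∀ i, ∑ l, c l * f l (z i) = 0) → c = 0 := by
  intro n
  induction n with
  | zero => intros; exact Subsingleton.elim _ _
  | succ n ih =>
    intro f hf hW c z hz hzmem hzero
    have hf0 : ∀ t ∈ Set.Ioo a b, f 0 t ≠ 0 := by
      intro t ht
      have := hW t ht 1 (by omega)
      simpa using this
    have hfAt : ∀ i, ∀ t ∈ Set.Ioo a b, ContDiffAt ℝ n (f i) t := fun i t ht =>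
      (hf i).contDiffAt (Ioo_mem_nhds ht.1 ht.2)
    have hg : ∀ i : Fin n, ContDiffOn ℝ n (fun s => f i.succ s / f 0 s) (Set.Ioo a b) :=
      fun i => (hf i.succ).div (hf 0) hf0
    have htail : ∀ i : Fin n, c i.succ = 0 := by
      rcases Nat.eq_zero_or_pos n with rfl | hn
      · exact fun i => i.elim0
      have hdiff : ∀ i : Fin n, ∀ t ∈ Set.Ioo a b,
          DifferentiableAt ℝ (fun s => f i.succ s / f 0 s) t := fun i t ht =>
        ((hg i).contDiffAt (Ioo_mem_nhds ht.1 ht.2)).differentiableAt (by simp; omega)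
      -- Division by `f 0` keeps the zeros and turns its coefficient into a constant, which
      -- differentiation removes. Rolle leaves `n` zeros for the `n` remaining functions.
      set q : ℝ → ℝ := fun s => c 0 + ∑ i : Fin n, c i.succ * (f i.succ s / f 0 s) with hq
      have hqd : ∀ t ∈ Set.Ioo a b, HasDerivAt q
          (∑ i : Fin n, c i.succ * deriv (fun s => f i.succ s / f 0 s) t) t := by
        intro t ht
        exact (HasDerivAt.fun_sum fun i _ => ((hdiff i t ht).hasDerivAt.const_mul _)).const_add _
      have hq0 : ∀ i, q (z i) = 0 := by
        intro i
        have h := hzero i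
        rw [Fin.sum_univ_succ] at h
        have h' : f 0 (z i) * q (z i) = 0 := by
          rw [← h, hq]
          simp only [mul_add, Finset.mul_sum]
          congr 1
          · ring
          · refine Finset.sum_congr rfl fun l _ => ?_
            field_simp [hf0 _ (hzmem i)]
        exact (mul_eq_zero.1 h').resolve_left (hf0 _ (hzmem i))
      have hcont : ContinuousOn q (Set.Icc (z 0) (z (Fin.last n))) := fun t ht =>
        (hqd t ⟨(hzmem 0).1.trans_le ht.1, ht.2.trans_lt (hzmem _).2⟩).continuousAt.continuousWithinAt
      obtain ⟨s, hs⟩ := exists_deriv_zeros_between hcont z hz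
        (fun i => ⟨hz.monotone (Fin.zero_le i), hz.monotone (Fin.le_last i)⟩) hq0
      have hsmem : ∀ i, s i ∈ Set.Ioo a b := fun i =>
        ⟨(hzmem _).1.trans (hs i).1, (hs i).2.1.trans (hzmem _).2⟩
      have := ih (fun i => deriv fun s => f i.succ s / f 0 s)
        (fun i => (hg i).deriv_of_isOpen isOpen_Ioo (by
          have : n - 1 + 1 ≤ n := by omega
          exact_mod_cast this)) ?_ (fun i => c i.succ) s
        (strictMono_of_between hz fun i => ⟨(hs i).1, (hs i).2.1⟩) hsmem
        (fun i => by rw [← (hqd _ (hsmem i)).deriv, (hs i).2.2])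
      · exact fun i => congrFun this i
      · intro t ht k hk
        have h1 := hW t ht (k + 1) (by omega)
        have h2 := wronskian_reduction (fun i => f (Fin.castLE (by omega : k + 1 ≤ n + 1) i)) t
          (fun i => (hfAt _ t ht).of_le (by exact_mod_cast hk)) (hf0 t ht)
        rw [h2] at h1
        exact (mul_ne_zero_iff.1 h1).2
    have h := hzero 0
    rw [Fin.sum_univ_succ] at h
    simp only [htail, zero_mul, Finset.sum_const_zero, add_zero] at h
    have hc0 := (mul_eq_zero.1 h).resolve_right (hf0 _ (hzmem 0))
    ext i
    exact Fin.cases hc0 htail i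

/-! ### Zeros of affine functionals along the curve -/

/-- Links the vector derivatives in `torsionMatrix` to the coordinate derivatives in the Wronskians.
-/
theorem iteratedDeriv_apply_of_contDiffOn {n : ℕ} {γ : ℝ → Fin n → ℝ} {U : Set ℝ} (hU : IsOpen U)
    {k : ℕ} (hγ : ContDiffOn ℝ k γ U) (i : Fin n) {t : ℝ} (ht : t ∈ U) :
    iteratedDeriv k γ t i = iteratedDeriv k (fun s => γ s i) t := by
  induction k generalizing γ with
  | zero => simp
  | succ k ih =>
    have hd : DifferentiableOn ℝ γ U := hγ.differentiableOn (by simp)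
    rw [iteratedDeriv_succ', iteratedDeriv_succ',
      ih (hγ.deriv_of_isOpen hU (by push_cast; exact le_rfl))]
    refine Filter.EventuallyEq.iteratedDeriv_eq k ?_
    filter_upwards [hU.mem_nhds ht] with s hs
    rw [deriv_pi (fun j => differentiableAt_pi.1 (hd.differentiableAt (hU.mem_nhds hs)) j)]

/-- For a curve with totally positive torsion, a derivative of a nontrivial linear functional has
fewer than `n` zeros. -/
theorem card_deriv_zeros_lt {n : ℕ} {a b : ℝ} {γ : ℝ → Fin n → ℝ}
    (hdiff : ContDiffOn ℝ n γ (Set.Ioo a b)) (htors : HasTotallyPositiveTorsion γ a b)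
    {c : Fin n → ℝ} (hc : c ≠ 0) (c₀ : ℝ) (Z : Finset ℝ) (hZ : ∀ z ∈ Z, z ∈ Set.Ioo a b)
    (hzero : ∀ z ∈ Z, deriv (fun t => c₀ + c ⬝ᵥ γ t) z = 0) : Z.card < n := by
  by_contra! hcard
  have hn : 1 ≤ n := by
    rcases Nat.eq_zero_or_pos n with rfl | h
    · exact absurd (Subsingleton.elim _ _) hc
    · exact h
  obtain ⟨Z', hZ', hcard'⟩ := Finset.exists_subset_card_eq hcard
  have hcomp : ∀ i, ContDiffOn ℝ n (fun t => γ t i) (Set.Ioo a b) := fun i =>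
    contDiffOn_pi.1 hdiff i
  refine hc (eq_zero_of_wronskian_ne_zero (a := a) (b := b) (fun i => deriv fun t => γ t i)
    (fun i => (hcomp i).deriv_of_isOpen isOpen_Ioo (by
      have : n - 1 + 1 ≤ n := by omega
      exact_mod_cast this)) ?_ c (Z'.orderEmbOfFin hcard') (OrderEmbedding.strictMono _)
      (fun i => hZ _ (hZ' (Finset.orderEmbOfFin_mem _ _ _))) fun i => ?_)
  · intro t ht k hk
    rcases Nat.eq_zero_or_pos k with rfl | hk0
    · simp
    convert (htors t ht k hk hk0).ne' using 1
    unfold leadingPrincipalMinor torsionMatrix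
    congr 1
    ext i j
    simp only [Matrix.of_apply, Matrix.submatrix_apply, Fin.val_castLE]
    rw [iteratedDeriv_apply_of_contDiffOn isOpen_Ioo (hdiff.of_le _) _ ht, iteratedDeriv_succ']
    have : (j : ℕ) + 1 ≤ n := by omega
    exact_mod_cast this
  · set z := Z'.orderEmbOfFin hcard' i
    have hz : z ∈ Z := hZ' (Finset.orderEmbOfFin_mem _ _ _)
    have hd : ∀ l, DifferentiableAt ℝ (fun t => γ t l) z := fun l =>
      ((hcomp l).contDiffAt (Ioo_mem_nhds (hZ z hz).1 (hZ z hz).2)).differentiableAt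
        (by simp; omega)
    rw [← hzero z hz]
    exact (((HasDerivAt.fun_sum fun l _ =>
      ((hd l).hasDerivAt.const_mul (c l))).const_add c₀).deriv).symm

theorem continuousOn_const_add_dotProduct {n : ℕ} {γ : ℝ → Fin n → ℝ} {s : Set ℝ} (c₀ : ℝ)
    (c : Fin n → ℝ) (hγ : ContinuousOn γ s) : ContinuousOn (fun t => c₀ + c ⬝ᵥ γ t) s := by
  unfold dotProduct
  fun_prop

/-- A nontrivial affine functional has at most `n` zeros on a curve with totally positive
torsion. -/
theorem card_zeros_le {n : ℕ} {a b : ℝ} {γ : ℝ → Fin n → ℝ}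
    (hcont : ContinuousOn γ (Set.Icc a b))
    (hdiff : ContDiffOn ℝ n γ (Set.Ioo a b)) (htors : HasTotallyPositiveTorsion γ a b)
    {c₀ : ℝ} {c : Fin n → ℝ} (hc : (c₀, c) ≠ 0) (Z : Finset ℝ) (hZ : ∀ z ∈ Z, z ∈ Set.Icc a b)
    (hzero : ∀ z ∈ Z, c₀ + c ⬝ᵥ γ z = 0) : Z.card ≤ n := by
  by_contra! hcard
  obtain ⟨m, hm⟩ : ∃ m, Z.card = m + 1 := ⟨Z.card - 1, by omega⟩
  let t := Z.orderEmbOfFin hm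
  have htZ : ∀ i, t i ∈ Z := fun i => Finset.orderEmbOfFin_mem _ _ _
  by_cases hc' : c = 0
  · have := hzero _ (htZ 0)
    subst hc'
    simp only [zero_dotProduct, add_zero] at this
    exact hc (by simp [this])
  have hg : ContinuousOn (fun t => c₀ + c ⬝ᵥ γ t) (Set.Icc a b) :=
    continuousOn_const_add_dotProduct c₀ c hcont
  obtain ⟨s, hs⟩ := exists_deriv_zeros_between hg t t.strictMono (fun i => hZ _ (htZ i))
    (fun i => hzero _ (htZ i))
  have hsm : StrictMono s := strictMono_of_between t.strictMono fun i => ⟨(hs i).1, (hs i).2.1⟩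
  have := card_deriv_zeros_lt hdiff htors hc' c₀ (Finset.univ.map ⟨s, hsm.injective⟩)
    (by
      simp only [Finset.mem_map, Finset.mem_univ, true_and, Function.Embedding.coeFn_mk,
        forall_exists_index, forall_apply_eq_imp_iff]
      exact fun i => ⟨(hZ _ (htZ _)).1.trans_lt (hs i).1, (hs i).2.1.trans_le (hZ _ (htZ _)).2⟩)
    (by
      simp only [Finset.mem_map, Finset.mem_univ, true_and, Function.Embedding.coeFn_mk,
        forall_exists_index, forall_apply_eq_imp_iff]
      exact fun i => (hs i).2.2)
  simp only [Finset.card_map, Finset.card_univ, Fintype.card_fin] at this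
  omega

/-- A supporting hyperplane of an initial arc meets the arc in at most `(n + 2) / 2` points. -/
theorem card_zeros_le_of_nonneg {n : ℕ} {a b : ℝ} {γ : ℝ → Fin n → ℝ}
    (hcont : ContinuousOn γ (Set.Icc a b))
    (hdiff : ContDiffOn ℝ n γ (Set.Ioo a b)) (htors : HasTotallyPositiveTorsion γ a b)
    {s : ℝ} (hsb : s ≤ b) {c₀ : ℝ} {c : Fin n → ℝ} (hc : c ≠ 0)
    (hnonneg : ∀ t ∈ Set.Icc a s, 0 ≤ c₀ + c ⬝ᵥ γ t)
    (Z : Finset ℝ) (hZ : ∀ z ∈ Z, z ∈ Set.Icc a s)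
    (hzero : ∀ z ∈ Z, c₀ + c ⬝ᵥ γ z = 0) : Z.card ≤ (n + 2) / 2 := by
  rcases Nat.lt_or_ge Z.card 2 with hlt | hge
  · omega
  obtain ⟨m, hm⟩ : ∃ m, Z.card = m + 1 + 1 := ⟨Z.card - 2, by omega⟩
  let t := Z.orderEmbOfFin hm
  have htZ : ∀ i, t i ∈ Z := fun i => Finset.orderEmbOfFin_mem _ _ _
  have hmem : ∀ i, t i ∈ Set.Icc a s := fun i => hZ _ (htZ i)
  have hg : ContinuousOn (fun t => c₀ + c ⬝ᵥ γ t) (Set.Icc a s) :=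
    (continuousOn_const_add_dotProduct c₀ c hcont).mono
      (Set.Icc_subset_Icc le_rfl hsb)
  obtain ⟨r, hr⟩ := exists_deriv_zeros_between hg t t.strictMono hmem
    (fun i => hzero _ (htZ i))
  have hrm : StrictMono r := strictMono_of_between t.strictMono fun i => ⟨(hr i).1, (hr i).2.1⟩
  -- Of the `m + 2` zeros, the `m` that are neither first nor last are interior minima. With the `m
  -- + 1` Rolle points this gives `2 * m + 1 < n`, hence `m + 2 ≤ (n + 2) / 2`.
  let u : Fin m → ℝ := fun i => t i.succ.castSucc
  have hu : ∀ i, u i ∈ Set.Ioo a s := fun i =>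
    ⟨(hmem 0).1.trans_lt (t.strictMono (by simp [Fin.lt_def])),
      (t.strictMono (Fin.castSucc_lt_last _)).trans_le (hmem (Fin.last _)).2⟩
  let v : Fin (m + 1) ⊕ Fin m → ℝ := Sum.elim r u
  have hv : Function.Injective v := by
    refine hrm.injective.sumElim ?_ ?_
    · intro i j hij
      simpa using t.injective hij
    · intro i j hij
      have h1 := (hr i).1
      have h2 := (hr i).2.1
      rw [hij] at h1 h2
      have h1' := t.lt_iff_lt.1 h1
      have h2' := t.lt_iff_lt.1 h2
      simp only [Fin.lt_def, Fin.val_succ, Fin.val_castSucc] at h1' h2'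
      omega
  have := card_deriv_zeros_lt hdiff htors hc c₀ (Finset.univ.map ⟨v, hv⟩)
    (by
      simp only [Finset.mem_map, Finset.mem_univ, true_and, Function.Embedding.coeFn_mk,
        forall_exists_index, forall_apply_eq_imp_iff]
      rintro (i | i)
      · exact ⟨(hmem _).1.trans_lt (hr i).1, (hr i).2.1.trans_le ((hmem _).2.trans hsb)⟩
      · exact ⟨(hu i).1, (hu i).2.trans_le hsb⟩)
    (by
      simp only [Finset.mem_map, Finset.mem_univ, true_and, Function.Embedding.coeFn_mk,
        forall_exists_index, forall_apply_eq_imp_iff]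
      rintro (i | i)
      · exact (hr i).2.2
      · refine IsLocalMin.deriv_eq_zero ?_
        filter_upwards [Ioo_mem_nhds (hu i).1 (hu i).2] with y hy
        have h0 : c₀ + c ⬝ᵥ γ (u i) = 0 := hzero _ (htZ _)
        change c₀ + c ⬝ᵥ γ (u i) ≤ _
        rw [h0]
        exact hnonneg y ⟨hy.1.le, hy.2.le⟩)
  simp only [Finset.card_map, Finset.card_univ, Fintype.card_sum, Fintype.card_fin] at this
  omega

/-! ### Compactness and separation of convex hulls -/

theorem sum_extend_zero {ι κ M : Type*} [Fintype ι] [Fintype κ] [AddCommMonoid M] (e : ι ↪ κ)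
    (q : ι → M) : ∑ j, Function.extend e q 0 j = ∑ i, q i := by
  classical
  rw [← Finset.sum_subset (Finset.subset_univ (Finset.univ.map e)), Finset.sum_map]
  · exact Finset.sum_congr rfl fun i _ => e.injective.extend_apply q 0 i
  · exact fun j _ hj => Function.extend_apply' _ _ _ (by simpa using hj)

/-- In finite dimension the convex hull of a compact set is compact. -/
theorem IsCompact.convexHull_of_finiteDimensional {E : Type*} [NormedAddCommGroup E]
    [NormedSpace ℝ E] [FiniteDimensional ℝ E] {K : Set E} (hK : IsCompact K) :
    IsCompact (convexHull ℝ K) := by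
  classical
  rcases K.eq_empty_or_nonempty with rfl | ⟨k₀, hk₀⟩
  · simp
  let N := Module.finrank ℝ E + 1
  have hP : IsCompact (stdSimplex ℝ (Fin N) ×ˢ Set.univ.pi fun _ : Fin N => K) :=
    (isCompact_stdSimplex ℝ (Fin N)).prod (isCompact_univ_pi fun _ => hK)
  have hΦ : Continuous fun p : (Fin N → ℝ) × (Fin N → E) => ∑ i, p.1 i • p.2 i := by fun_prop
  convert hP.image hΦ using 1
  ext x
  constructor
  · intro hx
    obtain ⟨ι, _, z, w, hz, hind, hw, hw1, hwx⟩ := eq_pos_convex_span_of_mem_convexHull hx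
    have hcard : Fintype.card ι ≤ Fintype.card (Fin N) := by
      simpa [N] using hind.card_le_finrank_succ.trans
        (Nat.succ_le_succ (Submodule.finrank_le _))
    obtain ⟨e⟩ := Function.Embedding.nonempty_of_card_le hcard
    -- Carathéodory may use fewer than `N` points; the rest are padded by `k₀` with weight zero.
    refine ⟨(Function.extend e w 0, Function.extend e z fun _ => k₀), ⟨⟨fun j => ?_, ?_⟩, ?_⟩, ?_⟩
    · by_cases h : ∃ i, e i = j
      · obtain ⟨i, rfl⟩ := h
        change 0 ≤ Function.extend e w 0 (e i)
        rw [e.injective.extend_apply]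
        exact (hw i).le
      · change 0 ≤ Function.extend e w 0 j
        rw [Function.extend_apply' _ _ _ h]
        exact le_rfl
    · exact (sum_extend_zero e w).trans hw1
    · intro j _
      by_cases h : ∃ i, e i = j
      · obtain ⟨i, rfl⟩ := h
        change Function.extend e z (fun _ => k₀) (e i) ∈ K
        rw [e.injective.extend_apply]
        exact hz ⟨i, rfl⟩
      · change Function.extend e z (fun _ => k₀) j ∈ K
        rw [Function.extend_apply' _ _ _ h]
        exact hk₀
    · rw [← hwx, ← sum_extend_zero e fun i => w i • z i]
      refine Finset.sum_congr rfl fun j _ => ?_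
      by_cases h : ∃ i, e i = j
      · obtain ⟨i, rfl⟩ := h
        simp only [e.injective.extend_apply]
      · simp only [Function.extend_apply' _ _ _ h, Pi.zero_apply, zero_smul]
  · rintro ⟨⟨w, z⟩, ⟨⟨hw0, hw1⟩, hz⟩, rfl⟩
    exact (convex_convexHull ℝ K).sum_mem (fun i _ => hw0 i) hw1
      fun i _ => subset_convexHull ℝ K (hz i trivial)

/-- A point outside the convex hull of a compact set is strictly separated from that set. -/
theorem exists_separating_dotProduct {n : ℕ} {K : Set (Fin n → ℝ)} (hK : IsCompact K)
    {x : Fin n → ℝ} (hx : x ∉ convexHull ℝ K) :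
    ∃ (c : Fin n → ℝ) (u : ℝ), c ⬝ᵥ x < u ∧ ∀ y ∈ K, u < c ⬝ᵥ y := by
  obtain ⟨f, u, hfx, hf⟩ := geometric_hahn_banach_point_closed (convex_convexHull ℝ K)
    hK.convexHull_of_finiteDimensional.isClosed hx
  have hrep : ∀ y, f y = (fun i => f (Pi.single i 1)) ⬝ᵥ y := by
    intro y
    conv_lhs => rw [← Finset.univ_sum_single y, map_sum]
    refine Finset.sum_congr rfl fun i _ => ?_
    rw [show (Pi.single i (y i) : Fin n → ℝ) = y i • Pi.single i 1 by simp [← Pi.single_smul],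
      map_smul, smul_eq_mul, mul_comm]
  refine ⟨_, u, hrep x ▸ hfx, fun y hy => hrep y ▸ hf y (subset_convexHull ℝ K hy)⟩

/-! ### Upper bound by the shortest arc -/

/-- The shortest initial arc whose convex hull contains `x` exists. -/
theorem exists_minimal_arc {n : ℕ} {a b : ℝ} (hab : a ≤ b) {γ : ℝ → Fin n → ℝ}
    (hcont : ContinuousOn γ (Set.Icc a b)) {x : Fin n → ℝ}
    (hx : x ∈ convexHull ℝ (γ '' Set.Icc a b)) :
    ∃ s ∈ Set.Icc a b, x ∈ convexHull ℝ (γ '' Set.Icc a s) ∧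
      ∀ r ∈ Set.Ico a s, x ∉ convexHull ℝ (γ '' Set.Icc a r) := by
  set S : Set ℝ := {s | s ∈ Set.Icc a b ∧ x ∈ convexHull ℝ (γ '' Set.Icc a s)} with hS
  have hbS : b ∈ S := ⟨⟨hab, le_rfl⟩, hx⟩
  have hbdd : BddBelow S := ⟨a, fun s hs => hs.1.1⟩
  have hs₀ : sInf S ∈ Set.Icc a b :=
    ⟨le_csInf ⟨b, hbS⟩ fun s hs => hs.1.1, csInf_le hbdd hbS⟩
  refine ⟨sInf S, hs₀, ?_, fun r hr hxr => ?_⟩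
  · by_contra hnot
    obtain ⟨c, u, hcx, hc⟩ := exists_separating_dotProduct
      (isCompact_Icc.image_of_continuousOn (hcont.mono (Set.Icc_subset_Icc le_rfl hs₀.2))) hnot
    have hg := continuousOn_const_add_dotProduct 0 c hcont
    simp only [zero_add] at hg
    -- Strict separation persists on slightly longer arcs, but some of these already have `x` in
    -- their hull.
    have hnear : ∀ᶠ t in nhdsWithin (sInf S) (Set.Icc a b), u < c ⬝ᵥ γ t :=
      (hg _ hs₀).eventually_const_lt (hc _ ⟨_, ⟨hs₀.1, le_rfl⟩, rfl⟩)
    obtain ⟨δ, hδ, hball⟩ := Metric.mem_nhdsWithin_iff.1 hnear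
    obtain ⟨s, hsS, hsδ⟩ := exists_lt_of_csInf_lt ⟨b, hbS⟩ (lt_add_of_pos_right (sInf S) hδ)
    have hsub : convexHull ℝ (γ '' Set.Icc a s) ⊆ {y | u < c ⬝ᵥ y} := by
      refine convexHull_min ?_ ?_
      · rintro _ ⟨t, ht, rfl⟩
        rcases le_or_gt t (sInf S) with h | h
        · exact hc _ ⟨t, ⟨ht.1, h⟩, rfl⟩
        · refine hball ⟨?_, ht.1, ht.2.trans hsS.1.2⟩
          rw [Metric.mem_ball, Real.dist_eq, abs_of_pos (sub_pos.2 h)]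
          linarith [ht.2]
      · exact convex_halfSpace_gt
          ⟨fun y z => dotProduct_add c y z, fun r y => dotProduct_smul r c y⟩ u
    exact (lt_asymm hcx) (hsub hsS.2)
  · exact absurd (csInf_le hbdd (show r ∈ S from ⟨⟨hr.1, hr.2.le.trans hs₀.2⟩, hxr⟩))
      (not_le.2 hr.2)

/-- At the end of the shortest arc whose hull contains `x`, the point `x` lies on a supporting
hyperplane. -/
theorem exists_supporting_functional {n : ℕ} {a s : ℝ} (has : a < s) {γ : ℝ → Fin n → ℝ}
    (hcont : ContinuousOn γ (Set.Icc a s)) {x : Fin n → ℝ}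
    (hmin : ∀ r ∈ Set.Ico a s, x ∉ convexHull ℝ (γ '' Set.Icc a r)) :
    ∃ c : Fin n → ℝ, c ≠ 0 ∧ ∀ t ∈ Set.Icc a s, 0 ≤ -(c ⬝ᵥ x) + c ⬝ᵥ γ t := by
  -- Unit normals weakly separating `x` from the arc up to `r`: compact sets decreasing in `r`.
  -- Normalization keeps the common element nonzero.
  let F : Set.Ico a s → Set (Fin n → ℝ) := fun r =>
    Metric.sphere 0 1 ∩ ⋂ t ∈ Set.Icc a r.1, {c | 0 ≤ -(c ⬝ᵥ x) + c ⬝ᵥ γ t}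
  have hclosed : ∀ r, IsClosed (F r) := fun r =>
    Metric.isClosed_sphere.inter (isClosed_biInter fun t _ =>
      isClosed_le continuous_const (by unfold dotProduct; fun_prop))
  have hcompact : ∀ r, IsCompact (F r) := fun r =>
    (isCompact_sphere 0 1).of_isClosed_subset (hclosed r) Set.inter_subset_left
  have hanti : ∀ {r r' : Set.Ico a s}, r ≤ r' → F r' ⊆ F r := fun {r r'} h =>
    Set.inter_subset_inter_right _ (Set.biInter_subset_biInter_left
      (Set.Icc_subset_Icc le_rfl h))
  have hne : ∀ r, (F r).Nonempty := by
    intro r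
    obtain ⟨c, u, hcx, hc⟩ := exists_separating_dotProduct (isCompact_Icc.image_of_continuousOn
      (hcont.mono (Set.Icc_subset_Icc le_rfl r.2.2.le))) (hmin r r.2)
    have hc0 : c ≠ 0 := by
      rintro rfl
      have := hc _ ⟨a, ⟨le_rfl, r.2.1⟩, rfl⟩
      simp only [zero_dotProduct] at this hcx
      exact lt_asymm this hcx
    refine ⟨‖c‖⁻¹ • c, ?_, ?_⟩
    · simp [norm_smul, hc0]
    · simp only [Set.mem_iInter, Set.mem_ofPred_eq, smul_dotProduct, smul_eq_mul]
      intro t ht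
      have := hc _ ⟨t, ht, rfl⟩
      rw [← mul_neg, ← mul_add]
      exact mul_nonneg (inv_nonneg.2 (norm_nonneg c)) (by linarith)
  have : Nonempty (Set.Ico a s) := ⟨⟨a, le_rfl, has⟩⟩
  obtain ⟨c, hc⟩ := IsCompact.nonempty_iInter_of_directed_nonempty_isCompact_isClosed F
    (fun r r' => ⟨max r r', hanti (le_max_left _ _), hanti (le_max_right _ _)⟩) hne hcompact hclosed
  rw [Set.mem_iInter] at hc
  refine ⟨c, ?_, ?_⟩
  · rintro rfl
    simpa using (hc ⟨a, le_rfl, has⟩).1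
  · have hIco : ∀ t ∈ Set.Ico a s, 0 ≤ -(c ⬝ᵥ x) + c ⬝ᵥ γ t := fun t ht =>
      Set.mem_iInter₂.1 (hc ⟨t, ht⟩).2 t ⟨ht.1, le_rfl⟩
    have hg := continuousOn_const_add_dotProduct (-(c ⬝ᵥ x)) c hcont
    rw [← closure_Ico has.ne] at hg ⊢
    exact fun t ht => le_on_closure hIco continuousOn_const hg ht

/-- Every point of the hull is a convex combination of at most `(n + 2) / 2` curve points. -/
theorem exists_isConvexCombinationOf_le {n : ℕ} {a b : ℝ} (hab : a < b) {γ : ℝ → Fin n → ℝ}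
    (hcont : ContinuousOn γ (Set.Icc a b))
    (hdiff : ContDiffOn ℝ n γ (Set.Ioo a b)) (htors : HasTotallyPositiveTorsion γ a b)
    {x : Fin n → ℝ} (hx : x ∈ convexHull ℝ (γ '' Set.Icc a b)) :
    ∃ k ≤ (n + 2) / 2, IsConvexCombinationOf (γ '' Set.Icc a b) k x := by
  obtain ⟨s, hs, hxs, hmin⟩ := exists_minimal_arc hab.le hcont hx
  obtain ⟨ι, _, z, w, hz, hind, hw, hw1, hwx⟩ := eq_pos_convex_span_of_mem_convexHull hxs
  choose t ht htz using fun i => hz ⟨i, rfl⟩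
  -- Affine independence makes the parameters distinct, so counting zeros counts points.
  have htinj : Function.Injective t := fun i j hij =>
    hind.injective (by rw [← htz, ← htz, hij])
  refine ⟨Fintype.card ι, ?_, z ∘ (Fintype.equivFin ι).symm, w ∘ (Fintype.equivFin ι).symm,
    fun i => ?_, fun i => (hw _).le, ?_, ?_⟩
  · have hcardZ : (Finset.univ.map ⟨t, htinj⟩).card = Fintype.card ι := by simp
    rw [← hcardZ]
    rcases hs.1.eq_or_lt with rfl | has
    · refine (Finset.card_le_one.2 ?_).trans (by omega)
      simp only [Set.Icc_self, Set.mem_singleton_iff] at ht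
      simp [ht]
    · obtain ⟨c, hc, hnonneg⟩ := exists_supporting_functional has
        (hcont.mono (Set.Icc_subset_Icc le_rfl hs.2)) hmin
      have hsum : ∑ i, w i * (-(c ⬝ᵥ x) + c ⬝ᵥ γ (t i)) = 0 := by
        have h : c ⬝ᵥ x = ∑ i, w i * (c ⬝ᵥ z i) := by
          rw [← hwx, dotProduct_sum]
          simp [dotProduct_smul]
        simp only [mul_add, Finset.sum_add_distrib, ← Finset.sum_mul, hw1, htz]
        rw [← h]
        ring
      have hzero : ∀ i, -(c ⬝ᵥ x) + c ⬝ᵥ γ (t i) = 0 := fun i =>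
        (mul_eq_zero.1 ((Finset.sum_eq_zero_iff_of_nonneg fun i _ =>
          mul_nonneg (hw i).le (hnonneg _ (ht i))).1 hsum i (Finset.mem_univ i))).resolve_left
          (hw i).ne'
      refine card_zeros_le_of_nonneg hcont hdiff htors hs.2 hc hnonneg _ ?_ ?_
      · simpa using ht
      · simpa using hzero
  · exact Set.image_mono (Set.Icc_subset_Icc le_rfl hs.2) (hz ⟨_, rfl⟩)
  · exact (Equiv.sum_comp _ w).trans hw1
  · exact (Equiv.sum_comp _ fun i => w i • z i).trans hwx

/-! ### Lower bound by interpolation -/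

/-- For at most `n` points of the curve and any further point there is an affine functional that
vanishes at the former but not at the latter. -/
theorem exists_affine_vanishing {n : ℕ} {a b : ℝ} (hab : a < b) {γ : ℝ → Fin n → ℝ}
    (hcont : ContinuousOn γ (Set.Icc a b))
    (hdiff : ContDiffOn ℝ n γ (Set.Ioo a b)) (htors : HasTotallyPositiveTorsion γ a b)
    (Z : Finset ℝ) (hZ : ∀ z ∈ Z, z ∈ Set.Icc a b) (hcard : Z.card ≤ n)
    {p : ℝ} (hp : p ∈ Set.Icc a b) (hpZ : p ∉ Z) :
    ∃ (c₀ : ℝ) (c : Fin n → ℝ), (∀ z ∈ Z, c₀ + c ⬝ᵥ γ z = 0) ∧ c₀ + c ⬝ᵥ γ p ≠ 0 := by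
  -- With exactly `n` nodes away from `p`, the `n + 1` coefficients allow a nonzero functional
  -- vanishing at all nodes; vanishing at `p` too would be one zero too many.
  obtain ⟨Z', hZZ', hZ', hcard'⟩ :
      ∃ Z' : Finset ℝ, Z ⊆ Z' ∧ (∀ z ∈ Z', z ∈ Set.Icc a b \ {p}) ∧ Z'.card = n := by
    obtain ⟨T, hT, hTcard⟩ := ((Set.Icc_infinite hab).sdiff
      (Z.cons p hpZ).finite_toSet).exists_subset_card_eq (n - Z.card)
    have hTZ : Disjoint Z T := Finset.disjoint_right.2 fun z hz hzZ =>
      (hT hz).2 (Finset.mem_coe.2 (Finset.mem_cons_of_mem hzZ))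
    refine ⟨Z.disjUnion T hTZ, fun z hz => Finset.mem_disjUnion.2 (Or.inl hz), fun z hz => ?_, ?_⟩
    · rcases Finset.mem_disjUnion.1 hz with h | h
      · exact ⟨hZ z h, fun hzp => hpZ (hzp ▸ h)⟩
      · exact ⟨(hT h).1, fun hzp => (hT h).2 (by simp [Set.mem_singleton_iff.1 hzp])⟩
    · rw [Finset.card_disjUnion, hTcard]
      omega
  let φ : (ℝ × (Fin n → ℝ)) →ₗ[ℝ] (Z' → ℝ) :=
    { toFun := fun q z => q.1 + q.2 ⬝ᵥ γ z
      map_add' := fun q q' => by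
        ext z
        simp only [Prod.fst_add, Prod.snd_add, add_dotProduct, Pi.add_apply]
        ring
      map_smul' := fun r q => by
        ext z
        simp [smul_dotProduct, mul_add] }
  have hker : LinearMap.ker φ ≠ ⊥ := by
    refine LinearMap.ker_ne_bot_of_finrank_lt ?_
    simp [hcard']
  obtain ⟨⟨c₀, c⟩, hq, hq0⟩ := Submodule.exists_mem_ne_zero_of_ne_bot hker
  have hvan : ∀ z ∈ Z', c₀ + c ⬝ᵥ γ z = 0 := fun z hz => congrFun hq ⟨z, hz⟩
  refine ⟨c₀, c, fun z hz => hvan z (hZZ' hz), fun hp0 => ?_⟩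
  have hpZ' : p ∉ Z' := fun h => (hZ' p h).2 rfl
  have := card_zeros_le hcont hdiff htors hq0 (Z'.cons p hpZ')
    (by
      simp only [Finset.mem_cons, forall_eq_or_imp]
      exact ⟨hp, fun z hz => (hZ' z hz).1⟩)
    (by
      simp only [Finset.mem_cons, forall_eq_or_imp]
      exact ⟨hp0, hvan⟩)
  rw [Finset.card_cons] at this
  omega

/-- Some point of the hull is not a convex combination of fewer than `(n + 2) / 2` curve
points. -/
theorem exists_le_of_isConvexCombinationOf {n : ℕ} {a b : ℝ} (hab : a < b) {γ : ℝ → Fin n → ℝ}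
    (hcont : ContinuousOn γ (Set.Icc a b))
    (hdiff : ContDiffOn ℝ n γ (Set.Ioo a b)) (htors : HasTotallyPositiveTorsion γ a b) :
    ∃ x ∈ convexHull ℝ (γ '' Set.Icc a b),
      ∀ k, IsConvexCombinationOf (γ '' Set.Icc a b) k x → (n + 2) / 2 ≤ k := by
  classical
  obtain ⟨T, hT, hTcard⟩ := (Set.Icc_infinite hab).exists_subset_card_eq ((n + 2) / 2)
  have hN : (0 : ℝ) < T.card := by
    rw [hTcard]
    exact_mod_cast (by omega : 0 < (n + 2) / 2)
  refine ⟨∑ t ∈ T, (T.card : ℝ)⁻¹ • γ t, ?_, ?_⟩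
  · refine (convex_convexHull ℝ _).sum_mem (fun _ _ => by positivity) ?_
      fun t ht => subset_convexHull ℝ _ ⟨t, hT ht, rfl⟩
    rw [Finset.sum_const, nsmul_eq_mul, mul_inv_cancel₀ hN.ne']
  · rintro k ⟨p, w, hp, hw, hw1, hwx⟩
    by_contra! hk
    choose σ hσ hσp using hp
    set D := Finset.univ.image σ
    have hD : D.card ≤ k := Finset.card_image_le.trans (by simp)
    obtain ⟨τ, hτT, hτD⟩ := Finset.exists_mem_notMem_of_card_lt_card
      (show D.card < T.card by omega)
    obtain ⟨c₀, c, hvan, hne⟩ := exists_affine_vanishing hab hcont hdiff htors (D ∪ T.erase τ)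
      (by
        intro z hz
        rcases Finset.mem_union.1 hz with h | h
        · obtain ⟨j, -, rfl⟩ := Finset.mem_image.1 h
          exact hσ j
        · exact hT (Finset.mem_of_mem_erase h))
      (by
        -- The bound is `k + (T.card - 1) ≤ 2 * T.card - 2 ≤ n`.
        have h1 := Finset.card_union_le D (T.erase τ)
        rw [Finset.card_erase_of_mem hτT] at h1
        omega)
      (hT hτT) (by simp [hτD])
    -- The functional takes the value zero at the point by one representation, and a nonzero value
    -- by the other, where only `τ` contributes.
    have hσ0 : ∑ j, w j * (c₀ + c ⬝ᵥ γ (σ j)) = 0 :=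
      Finset.sum_eq_zero fun j _ => by
        rw [hvan _ (Finset.mem_union_left _ (Finset.mem_image_of_mem σ (Finset.mem_univ j))),
          mul_zero]
    have hτ0 : ∑ t ∈ T, (T.card : ℝ)⁻¹ * (c₀ + c ⬝ᵥ γ t) =
        (T.card : ℝ)⁻¹ * (c₀ + c ⬝ᵥ γ τ) :=
      Finset.sum_eq_single_of_mem τ hτT fun t ht htτ => by
        rw [hvan t (Finset.mem_union_right _ (Finset.mem_erase.2 ⟨htτ, ht⟩)), mul_zero]
    have h1 : ∑ j, w j * (c₀ + c ⬝ᵥ γ (σ j)) = c₀ + c ⬝ᵥ ∑ j, w j • p j := by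
      simp only [mul_add, Finset.sum_add_distrib, ← Finset.sum_mul, hw1, one_mul, hσp,
        dotProduct_sum, dotProduct_smul, smul_eq_mul]
    have h2 : ∑ t ∈ T, (T.card : ℝ)⁻¹ * (c₀ + c ⬝ᵥ γ t) =
        c₀ + c ⬝ᵥ ∑ t ∈ T, (T.card : ℝ)⁻¹ • γ t := by
      simp only [mul_add, Finset.sum_add_distrib, dotProduct_sum, dotProduct_smul, smul_eq_mul,
        Finset.sum_const, nsmul_eq_mul]
      rw [← mul_assoc, mul_inv_cancel₀ hN.ne', one_mul]
    rw [hwx, ← h2, hτ0, hσ0] at h1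
    exact mul_ne_zero (inv_ne_zero hN.ne') hne h1.symm

theorem corollary2p6 {n : ℕ} {a b : ℝ} (hab : a < b) (γ : ℝ → Fin n → ℝ)
    (hcont : ContinuousOn γ (Set.Icc a b))
    (hdiff : ContDiffOn ℝ n γ (Set.Ioo a b))
    (htors : HasTotallyPositiveTorsion γ a b) :
    caratheodoryNumber (γ '' Set.Icc a b) = (((n + 2) / 2 : ℕ) : ℕ∞) := by
  refine le_antisymm (iSup₂_le fun x hx => ?_) ?_
  · obtain ⟨k, hk, hkx⟩ := exists_isConvexCombinationOf_le hab hcont hdiff htors hx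
    exact (iInf₂_le k hkx).trans (by exact_mod_cast hk)
  · obtain ⟨x, hx, hmin⟩ := exists_le_of_isConvexCombinationOf hab hcont hdiff htors
    exact le_iSup₂_of_le x hx (le_iInf₂ fun k hk => by exact_mod_cast hmin k hk)
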